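/- Let $(\breve N,\breve g)$ be a finite-dimensional smooth semi-Riemannian manifold with Levi-Civita connection $\breve\nabla$, and let $\breve P$ be a locally Golden structure on it: a smooth $(1,1)$-tensor field with $\breve P^2=\breve P+I$, $\breve g(\breve PX,Y)=\breve g(X,\breve PY)$ and $\breve\nabla\breve P=0$. Let $\acute N$ be an immersed lightlike submanifold of $\breve N$: the radical $\mathrm{Rad}\,T\acute N=T\acute N\cap T\acute N^{\perp}$ has constant rank $r\ge 1$. Choose smooth vector bundles $S(T\acute N)$, $S(T\acute N^{\perp})$ and $\mathrm{ltr}(T\acute N)$ over $\acute N$ with $$T\acute N=\mathrm{Rad}\,T\acute N\perp S(T\acute N),\qquad T\acute N^{\perp}=\mathrm{Rad}\,T\acute N\perp S(T\acute N^{\perp}),$$ $$T\breve N|_{\acute N}=S(T\acute N)\perp[\mathrm{Rad}\,T\acute N\oplus \mathrm{ltr}(T\acute N)]\perp S(T\acute N^{\perp}),$$ and put $\mathrm{tr}(T\acute N)=\mathrm{ltr}(T\acute N)\perp S(T\acute N^{\perp})$, so that $T\breve N|_{\acute N}=T\acute N\oplus \mathrm{tr}(T\acute N)$. (The bundle $\mathrm{ltr}(T\acute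 N)$ may, but need not, be totally null.) Assume that $\acute N$ is transversal lightlike: $\breve P(\mathrm{Rad}\,T\acute N)=\mathrm{ltr}(T\acute N)$ and $\breve P(S(T\acute N))\subseteq S(T\acute N^{\perp})$. For $W,U\in\Gamma(T\acute N)$ let $\nabla_WU$ be the $T\acute N$-component of $\breve\nabla_WU$; for $V\in\Gamma(\mathrm{tr}(T\acute N))$ let $-A_VW$ be the $T\acute N$-component of $\breve\nabla_WV$; and for $U\in\Gamma(S(T\acute N))$ let $h^{*}(W,U)$ be the $\mathrm{Rad}\,T\acute N$-component of $\nabla_WU$ in $T\acute N=\mathrm{Rad}\,T\acute N\oplus S(T\acute N)$. Then $S(T\acute N)$ defines a totally geodesic foliation on $\acute N$ (that is, for all $W,U\in\Gamma(S(T\acute N))$ both $[W,U]$ and $\nabla_WU$ lie in $\Gamma(S(T\acute N))$) if and only if, for all $W,U\in\Gamma(S(T\acute N))$, $$h^{*}(W,U)=0\quad\text{and}\quad A_{\breve PU}W\ \text{has no component in}\ \mathrm{Rad}\,T\acute N .$$ -/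

import Mathlib

open Bundle Topology
open scoped Manifold ContDiff

noncomputable section

namespace GoldenLightlike

section Ambient

variable {F : Type*} [NormedAddCommGroup F] [NormedSpace ℝ F]
  {M : Type*} [TopologicalSpace M] [ChartedSpace F M] [IsManifold 𝓘(ℝ, F) ∞ M]

variable (F M) in
/-- A semi-Riemannian metric on `M`: a smooth field of symmetric nondegenerate bilinear forms, of
arbitrary signature. -/
structure SemiRiemannianMetric where
  /-- The bilinear form on the tangent space at `p`. -/
  val (p : M) : TangentSpace 𝓘(ℝ, F) p →L[ℝ] TangentSpace 𝓘(ℝ, F) p →L[ℝ] ℝ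
  symm (p : M) (v w : TangentSpace 𝓘(ℝ, F) p) : val p v w = val p w v
  nondegenerate (p : M) (v : TangentSpace 𝓘(ℝ, F) p) (hv : ∀ w, val p v w = 0) : v = 0
  contMDiff : ContMDiff 𝓘(ℝ, F) (𝓘(ℝ, F).prod 𝓘(ℝ, F →L[ℝ] F →L[ℝ] ℝ)) ∞
    (fun p ↦ TotalSpace.mk' (F →L[ℝ] F →L[ℝ] ℝ)
      (E := fun p : M ↦ TangentSpace 𝓘(ℝ, F) p →L[ℝ] TangentSpace 𝓘(ℝ, F) p →L[ℝ] ℝ) p (val p))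

/-- `D` is the Levi-Civita connection of `g`: it is torsion-free, and
`v (g(Y, Z)) = g(D_v Y, Z) + g(Y, D_v Z)` for vector fields `Y`, `Z` differentiable at `p` and
`v ∈ T_p M`. (In Mathlib `D Y p v` stands for `D_v Y`.) -/
structure IsLeviCivita [FiniteDimensional ℝ F] (g : SemiRiemannianMetric F M)
    (D : CovariantDerivative 𝓘(ℝ, F) F (TangentSpace 𝓘(ℝ, F) : M → Type _)) : Prop where
  torsion_eq_zero : D.torsion = 0
  metric (p : M) (Y Z : Π q : M, TangentSpace 𝓘(ℝ, F) q)
    (hY : MDifferentiableAt 𝓘(ℝ, F) 𝓘(ℝ, F).tangent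
      (fun q ↦ (⟨q, Y q⟩ : TangentBundle 𝓘(ℝ, F) M)) p)
    (hZ : MDifferentiableAt 𝓘(ℝ, F) 𝓘(ℝ, F).tangent
      (fun q ↦ (⟨q, Z q⟩ : TangentBundle 𝓘(ℝ, F) M)) p)
    (v : TangentSpace 𝓘(ℝ, F) p) :
    mvfderiv 𝓘(ℝ, F) (fun q ↦ g.val q (Y q) (Z q)) p v =
      g.val p (D Y p v) (Z p) + g.val p (Y p) (D Z p v)

/-- A Golden structure compatible with `g`: a smooth `(1,1)`-tensor field `P` with `P² = P + I` and
`g(Pv, w) = g(v, Pw)`. -/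
structure GoldenStructure (g : SemiRiemannianMetric F M) where
  /-- The endomorphism of the tangent space at `p`. -/
  toFun (p : M) : TangentSpace 𝓘(ℝ, F) p →L[ℝ] TangentSpace 𝓘(ℝ, F) p
  contMDiff : ContMDiff 𝓘(ℝ, F) (𝓘(ℝ, F).prod 𝓘(ℝ, F →L[ℝ] F)) ∞
    (fun p ↦ TotalSpace.mk' (F →L[ℝ] F)
      (E := fun p : M ↦ TangentSpace 𝓘(ℝ, F) p →L[ℝ] TangentSpace 𝓘(ℝ, F) p) p (toFun p))
  sq_eq (p : M) (v : TangentSpace 𝓘(ℝ, F) p) : toFun p (toFun p v) = toFun p v + v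
  compatible (p : M) (v w : TangentSpace 𝓘(ℝ, F) p) :
    g.val p (toFun p v) w = g.val p v (toFun p w)

/-- `P` is locally Golden: it is parallel, `D_v (P Y) = P (D_v Y)`. -/
def GoldenStructure.IsLocallyGolden {g : SemiRiemannianMetric F M} (P : GoldenStructure g)
    (D : CovariantDerivative 𝓘(ℝ, F) F (TangentSpace 𝓘(ℝ, F) : M → Type _)) : Prop :=
  ∀ (p : M) (Y : Π q : M, TangentSpace 𝓘(ℝ, F) q),
    MDifferentiableAt 𝓘(ℝ, F) 𝓘(ℝ, F).tangent
      (fun q ↦ (⟨q, Y q⟩ : TangentBundle 𝓘(ℝ, F) M)) p →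
    ∀ v : TangentSpace 𝓘(ℝ, F) p, D (fun q ↦ P.toFun q (Y q)) p v = P.toFun p (D Y p v)

end Ambient

section Submanifold

variable {E : Type*} [NormedAddCommGroup E] [NormedSpace ℝ E]
  {N : Type*} [TopologicalSpace N] [ChartedSpace E N]
  {F : Type*} [NormedAddCommGroup F] [NormedSpace ℝ F]
  {M : Type*} [TopologicalSpace M] [ChartedSpace F M]

/-- The differential `df_x : T_x N → T_{f x} M`. -/
abbrev diff (f : N → M) (x : N) :
    TangentSpace 𝓘(ℝ, E) x →L[ℝ] TangentSpace 𝓘(ℝ, F) (f x) :=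
  mfderiv 𝓘(ℝ, E) 𝓘(ℝ, F) f x

section SmoothManifolds

variable [IsManifold 𝓘(ℝ, E) ∞ N] [IsManifold 𝓘(ℝ, F) ∞ M]

/-- The covariant derivative along `f` of a section `V` of `f^* TM`, i.e. the pullback connection,
in the direction of a tangent vector of `N` at `x`: in the trivialization of `TM` at `f x` write
`V = ∑ Vᵃ (eₐ ∘ f)` with `eₐ` the constant sections; then
`D_w V = ∑ (w Vᵃ) eₐ + ∑ Vᵃ D_{df w} eₐ`. -/
def covAlong (D : CovariantDerivative 𝓘(ℝ, F) F (TangentSpace 𝓘(ℝ, F) : M → Type _))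
    (f : N → M) (V : Π x : N, TangentSpace 𝓘(ℝ, F) (f x)) (x : N) :
    TangentSpace 𝓘(ℝ, E) x →L[ℝ] TangentSpace 𝓘(ℝ, F) (f x) :=
  ((trivializationAt F (TangentSpace 𝓘(ℝ, F) : M → Type _) (f x)).symmL ℝ (f x)).comp
      (mvfderiv 𝓘(ℝ, E) (fun y : N ↦ (trivializationAt F
        (TangentSpace 𝓘(ℝ, F) : M → Type _) (f x) ⟨f y, V y⟩).2) x)
    + (D (FiberBundle.extend F (V x)) (f x)).comp (diff f x)

/-- The spaces `B x ⊆ T_{f x} M`, `x ∈ N`, form a smooth vector subbundle of `f^* TM`: near every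
point they have a smooth frame. For `f = id` these are the smooth distributions on `N`. -/
def IsSmoothSubbundle (f : N → M) (B : Π x : N, Submodule ℝ (TangentSpace 𝓘(ℝ, F) (f x))) :
    Prop :=
  ∀ x₀ : N, ∃ u ∈ 𝓝 x₀, ∃ (k : ℕ) (s : Fin k → Π x : N, TangentSpace 𝓘(ℝ, F) (f x)),
    (∀ i, ContMDiffOn 𝓘(ℝ, E) 𝓘(ℝ, F).tangent ∞
      (fun x ↦ (⟨f x, s i x⟩ : TangentBundle 𝓘(ℝ, F) M)) u) ∧
    ∀ x ∈ u, LinearIndependent ℝ (fun i ↦ s i x) ∧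
      Submodule.span ℝ (Set.range fun i ↦ s i x) = B x

/-- `U` is a smooth vector field on `N` with values in the distribution `B`. -/
def IsSmoothSection (B : Π x : N, Submodule ℝ (TangentSpace 𝓘(ℝ, E) x))
    (U : Π x : N, TangentSpace 𝓘(ℝ, E) x) : Prop :=
  ContMDiff 𝓘(ℝ, E) 𝓘(ℝ, E).tangent ∞ (fun x ↦ (⟨x, U x⟩ : TangentBundle 𝓘(ℝ, E) N)) ∧
    ∀ x, U x ∈ B x

end SmoothManifolds

variable [IsManifold 𝓘(ℝ, F) ∞ M]

/-- The radical `Rad T_x N` of the form induced by `g` on `T_x N`. -/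
def radical (g : SemiRiemannianMetric F M) (f : N → M) (x : N) :
    Submodule ℝ (TangentSpace 𝓘(ℝ, E) x) where
  carrier := {v | ∀ w : TangentSpace 𝓘(ℝ, E) x, g.val (f x) (diff f x v) (diff f x w) = 0}
  zero_mem' w := by simp
  add_mem' hv hv' w := by simp [hv w, hv' w]
  smul_mem' c v hv w := by simp [hv w]

/-- The normal space `T_x N^⊥ ⊆ T_{f x} M`. -/
def normalSpace (g : SemiRiemannianMetric F M) (f : N → M) (x : N) :
    Submodule ℝ (TangentSpace 𝓘(ℝ, F) (f x)) where
  carrier := {u | ∀ w : TangentSpace 𝓘(ℝ, E) x, g.val (f x) u (diff f x w) = 0}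
  zero_mem' w := by simp
  add_mem' hv hv' w := by simp [hv w, hv' w]
  smul_mem' c v hv w := by simp [hv w]

/-- The image `df (T_x N)` of the tangent space in `T_{f x} M`. -/
def tangentImage (f : N → M) (x : N) : Submodule ℝ (TangentSpace 𝓘(ℝ, F) (f x)) :=
  LinearMap.range (diff (E := E) f x).toLinearMap

/-- The image of a subspace of `T_x N` in `T_{f x} M`. -/
def pushSubspace (f : N → M) (x : N) (B : Submodule ℝ (TangentSpace 𝓘(ℝ, E) x)) :
    Submodule ℝ (TangentSpace 𝓘(ℝ, F) (f x)) :=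
  B.map (diff f x).toLinearMap

variable [IsManifold 𝓘(ℝ, E) ∞ N]

/-- A lightlike submanifold `(N, g, S(TN), S(TN^⊥))` immersed in `(M, g)` by `f`, together with a
transversal bundle `ltr(TN)`. The radical distribution has constant rank `r ≥ 1`, and
`TN = Rad TN ⊥ S(TN)`, `TN^⊥ = Rad TN ⊥ S(TN^⊥)`, `tr(TN) = ltr(TN) ⊥ S(TN^⊥)` is complementary to
`TN`, so that `f^* TM = S(TN) ⊥ [Rad TN ⊕ ltr(TN)] ⊥ S(TN^⊥)`.

The usual choice of `ltr(TN)` is moreover totally null. This is deliberately not required here: it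
only enlarges the class of objects, the usual choices being among those allowed. -/
structure LightlikeSubmanifold (g : SemiRiemannianMetric F M) (f : N → M) (r : ℕ) where
  contMDiff : ContMDiff 𝓘(ℝ, E) 𝓘(ℝ, F) ∞ f
  injective_diff (x : N) : Function.Injective (diff (E := E) (F := F) f x)
  one_le_rank : 1 ≤ r
  finrank_radical (x : N) : Module.finrank ℝ (radical (E := E) g f x) = r
  /-- The screen distribution `S(TN)`. -/
  screen (x : N) : Submodule ℝ (TangentSpace 𝓘(ℝ, E) x)
  /-- The screen transversal bundle `S(TN^⊥)`. -/
  screenTr (x : N) : Submodule ℝ (TangentSpace 𝓘(ℝ, F) (f x))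
  /-- The transversal bundle `ltr(TN)`. -/
  ltr (x : N) : Submodule ℝ (TangentSpace 𝓘(ℝ, F) (f x))
  smooth_screen : IsSmoothSubbundle (E := E) (F := E) (fun x : N ↦ x) screen
  smooth_screenTr : IsSmoothSubbundle (E := E) f screenTr
  smooth_ltr : IsSmoothSubbundle (E := E) f ltr
  isCompl_screen (x : N) : IsCompl (radical g f x) (screen x)
  disjoint_screenTr (x : N) : Disjoint (pushSubspace f x (radical (E := E) g f x)) (screenTr x)
  sup_screenTr (x : N) :
    pushSubspace f x (radical (E := E) g f x) ⊔ screenTr x = normalSpace (E := E) g f x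
  ltr_orthogonal_screen (x : N) :
    ∀ n ∈ ltr x, ∀ s ∈ screen x, g.val (f x) n (diff f x s) = 0
  ltr_orthogonal_screenTr (x : N) :
    ∀ n ∈ ltr x, ∀ z ∈ screenTr x, g.val (f x) n z = 0
  disjoint_ltr (x : N) : Disjoint (ltr x) (screenTr x)
  isCompl_tr (x : N) : IsCompl (tangentImage (E := E) f x) (ltr x ⊔ screenTr x)

namespace LightlikeSubmanifold

variable {g : SemiRiemannianMetric F M} {f : N → M} {r : ℕ}

/-- The component in `T_x N` of a vector of `T_{f x} M = T_x N ⊕ tr(TN)_x`. -/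
def tangentPart (L : LightlikeSubmanifold (E := E) g f r) (x : N)
    (v : TangentSpace 𝓘(ℝ, F) (f x)) : TangentSpace 𝓘(ℝ, E) x :=
  (LinearEquiv.ofInjective (diff (E := E) (F := F) f x).toLinearMap (L.injective_diff x)).symm
    ((tangentImage (E := E) f x).projectionOnto (L.ltr x ⊔ L.screenTr x) (L.isCompl_tr x) v)

/-- The component in `Rad T_x N` of a vector of `T_x N = Rad T_x N ⊕ S(TN)_x`. -/
def radicalPart (L : LightlikeSubmanifold (E := E) g f r) (x : N)
    (v : TangentSpace 𝓘(ℝ, E) x) : TangentSpace 𝓘(ℝ, E) x :=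
  (radical g f x).projection (L.screen x) (L.isCompl_screen x) v

/-- The induced connection `∇_W U` on `N`: the tangential part of the ambient derivative of `U`
(Gauss formula). -/
def inducedCov (L : LightlikeSubmanifold (E := E) g f r)
    (D : CovariantDerivative 𝓘(ℝ, F) F (TangentSpace 𝓘(ℝ, F) : M → Type _))
    (W U : Π x : N, TangentSpace 𝓘(ℝ, E) x) (x : N) : TangentSpace 𝓘(ℝ, E) x :=
  L.tangentPart x (covAlong D f (fun y ↦ diff f y (U y)) x (W x))

/-- The shape operator `A_V W` for a section `V` of `tr(TN)`: minus the tangential part of the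
ambient derivative of `V` in the direction `W` (Weingarten formula). -/
def shape (L : LightlikeSubmanifold (E := E) g f r)
    (D : CovariantDerivative 𝓘(ℝ, F) F (TangentSpace 𝓘(ℝ, F) : M → Type _))
    (V : Π x : N, TangentSpace 𝓘(ℝ, F) (f x)) (W : Π x : N, TangentSpace 𝓘(ℝ, E) x) (x : N) :
    TangentSpace 𝓘(ℝ, E) x :=
  -L.tangentPart x (covAlong D f V x (W x))

/-- `h*(W, U)` for a section `U` of `S(TN)`: the `Rad TN`-component in
`∇_W U = ∇*_W U + h*(W, U)`. -/
def hStar (L : LightlikeSubmanifold (E := E) g f r)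
    (D : CovariantDerivative 𝓘(ℝ, F) F (TangentSpace 𝓘(ℝ, F) : M → Type _))
    (W U : Π x : N, TangentSpace 𝓘(ℝ, E) x) (x : N) : TangentSpace 𝓘(ℝ, E) x :=
  L.radicalPart x (L.inducedCov D W U x)

/-- `S(TN)` defines a totally geodesic foliation on `(N, ∇)`: it is involutive, and its leaves are
totally geodesic with respect to the induced connection, i.e. `∇_W U` is a section of `S(TN)`
for all sections `W`, `U` of `S(TN)`. -/
def ScreenTotallyGeodesic (L : LightlikeSubmanifold (E := E) g f r)
    (D : CovariantDerivative 𝓘(ℝ, F) F (TangentSpace 𝓘(ℝ, F) : M → Type _)) : Prop :=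
  ∀ W U : Π x : N, TangentSpace 𝓘(ℝ, E) x,
    IsSmoothSection L.screen W → IsSmoothSection L.screen U → ∀ x : N,
      VectorField.mlieBracket 𝓘(ℝ, E) W U x ∈ L.screen x ∧ L.inducedCov D W U x ∈ L.screen x

/-- Transversal lightlike submanifolds: `P (Rad TN) = ltr(TN)` and `P (S(TN)) ⊆ S(TN^⊥)`. -/
structure IsTransversal (L : LightlikeSubmanifold (E := E) g f r) (P : GoldenStructure g) :
    Prop where
  map_radical (x : N) :
    (pushSubspace f x (radical (E := E) g f x)).map (P.toFun (f x)).toLinearMap = L.ltr x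
  map_screen (x : N) :
    (pushSubspace f x (L.screen x)).map (P.toFun (f x)).toLinearMap ≤ L.screenTr x

end LightlikeSubmanifold

end Submanifold

end GoldenLightlike

end

/-! Write D for the pullback of the Levi-Civita connection along `f`. Since `D` is torsion-free,
taking tangential parts gives `[W, U] = ∇_W U - ∇_U W`, so the foliation condition amounts to `h* =
0` on the screen. The real content is that `h* = 0` forces the condition on the shape operator.

The radical part of a vector `v` is read off by pairing with `P ξ - ξ = P⁻¹ ξ`, `ξ` radical: it
vanishes iff `g(v, Pξ) = g(v, ξ)` for all such `ξ` (`radicalPart_tangentPart_eq_zero_iff`). Put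
`a(W, U) = g(D_W U, Pξ)` and `b(W, U) = g(D_W U, ξ)`, so that `h* = 0` says `a = b`. Here `b` is
symmetric, because `[W, U]` is tangent and `ξ` is radical, while `a` is antisymmetric
(`val_covAlong_apply_antisymm`), because `P` sends the screen into the normal bundle, `P` is
parallel and `D` is metric and torsion-free. Hence `a = b = 0`. As `D_W (PU) = P D_W U` and `P² = P
+ I`, the criterion for `D_W (PU)` reads `a + b = a`, which holds.

The remaining lemmas transfer metricity, parallelism of `P` and vanishing torsion to sections along
`f`, by computing in the trivialization of the tangent bundle at one point. -/

namespace GoldenLightlike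

/-! ### Derivatives of vector-valued functions and the Lie bracket -/

section VectorValued

variable {E : Type*} [NormedAddCommGroup E] [NormedSpace ℝ E]
  {N : Type*} [TopologicalSpace N] [ChartedSpace E N]
  {G G' : Type*} [NormedAddCommGroup G] [NormedSpace ℝ G]
  [NormedAddCommGroup G'] [NormedSpace ℝ G']

theorem hasMFDerivAt_of_mdifferentiableAt {v : N → G} {x : N}
    (hv : MDifferentiableAt 𝓘(ℝ, E) 𝓘(ℝ, G) v x) :
    HasMFDerivAt 𝓘(ℝ, E) 𝓘(ℝ, G) v x (mvfderiv 𝓘(ℝ, E) v x : E →L[ℝ] G) :=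
  hv.hasMFDerivAt

theorem mvfderiv_eq_of_hasMFDerivAt {v : N → G} {x : N} {v' : E →L[ℝ] G}
    (hv : HasMFDerivAt 𝓘(ℝ, E) 𝓘(ℝ, G) v x v') :
    mvfderiv 𝓘(ℝ, E) v x = v' :=
  hv.mfderiv

theorem mvfderiv_congr {v v' : N → G} {x : N} (h : v =ᶠ[𝓝 x] v') :
    (mvfderiv 𝓘(ℝ, E) v x : E →L[ℝ] G) = mvfderiv 𝓘(ℝ, E) v' x :=
  h.mfderiv_eq

/-- Leibniz rule for the evaluation of a field of linear maps on a field of vectors. -/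
theorem mvfderiv_clm_apply {Φ : N → G →L[ℝ] G'} {v : N → G} {x : N}
    (hΦ : MDifferentiableAt 𝓘(ℝ, E) 𝓘(ℝ, G →L[ℝ] G') Φ x)
    (hv : MDifferentiableAt 𝓘(ℝ, E) 𝓘(ℝ, G) v x) (w : TangentSpace 𝓘(ℝ, E) x) :
    mvfderiv 𝓘(ℝ, E) (fun y ↦ Φ y (v y)) x w =
      mvfderiv 𝓘(ℝ, E) Φ x w (v x) + Φ x (mvfderiv 𝓘(ℝ, E) v x w) := by
  have h := (hasMFDerivAt_of_mdifferentiableAt hΦ).2.clm_apply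
    (hasMFDerivAt_of_mdifferentiableAt hv).2
  have h' : HasMFDerivAt 𝓘(ℝ, E) 𝓘(ℝ, G') (fun y ↦ Φ y (v y)) x _ :=
    ⟨hΦ.continuousAt.clm_apply hv.continuousAt, h⟩
  rw [mvfderiv_eq_of_hasMFDerivAt h']
  simp [writtenInExtChartAt, add_comm]
  rfl

theorem mvfderiv_comp_diff {F : Type*} [NormedAddCommGroup F] [NormedSpace ℝ F]
    {M : Type*} [TopologicalSpace M] [ChartedSpace F M] {f : N → M} {v : M → G} {x : N}
    (hv : MDifferentiableAt 𝓘(ℝ, F) 𝓘(ℝ, G) v (f x))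
    (hf : MDifferentiableAt 𝓘(ℝ, E) 𝓘(ℝ, F) f x) (w : TangentSpace 𝓘(ℝ, E) x) :
    mvfderiv 𝓘(ℝ, E) (fun y ↦ v (f y)) x w = mvfderiv 𝓘(ℝ, F) v (f x) (diff f x w) :=
  mfderiv_comp_apply x hv hf w

/-- The second derivative of a function is symmetric up to the Lie bracket:
`X (dφ Y) - Y (dφ X) = dφ [X, Y]`. -/
theorem mvfderiv_mvfderiv_sub [CompleteSpace E] [IsManifold 𝓘(ℝ, E) ∞ N] {φ : N → G} {x : N}
    (hφ : ContMDiffAt 𝓘(ℝ, E) 𝓘(ℝ, G) ∞ φ x) {X Y : Π y : N, TangentSpace 𝓘(ℝ, E) y}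
    (hX : MDifferentiableAt 𝓘(ℝ, E) 𝓘(ℝ, E).tangent
      (fun y ↦ (⟨y, X y⟩ : TangentBundle 𝓘(ℝ, E) N)) x)
    (hY : MDifferentiableAt 𝓘(ℝ, E) 𝓘(ℝ, E).tangent
      (fun y ↦ (⟨y, Y y⟩ : TangentBundle 𝓘(ℝ, E) N)) x) :
    mvfderiv 𝓘(ℝ, E) (fun y ↦ mvfderiv 𝓘(ℝ, E) φ y (Y y)) x (X x)
      - mvfderiv 𝓘(ℝ, E) (fun y ↦ mvfderiv 𝓘(ℝ, E) φ y (X y)) x (Y x) =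
      mvfderiv 𝓘(ℝ, E) φ x (VectorField.mlieBracket 𝓘(ℝ, E) X Y x) := by
  have : IsManifold 𝓘(ℝ, E) 1 N := .of_le (n := ∞) (by simp)
  have : IsManifold 𝓘(ℝ, E) 2 N := .of_le (n := ∞) ENat.LEInfty.out
  set c := extChartAt 𝓘(ℝ, E) x with hc
  set ψ : E → G := fun z ↦ φ (c.symm z) with hψ
  -- `hat Z` is the coordinate expression of `Z` in the chart at `x`; it reduces the claim to
  -- calculus for `ψ` on `E`.
  let hat (Z : Π y : N, TangentSpace 𝓘(ℝ, E) y) : E → E :=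
    VectorField.mpullbackWithin 𝓘(ℝ, E) 𝓘(ℝ, E) c.symm Z (Set.range 𝓘(ℝ, E))
  have hcx : c.symm (c x) = x := extChartAt_to_inv x
  have hψ2 : ContDiffAt ℝ ∞ ψ (c x) := by
    rw [← contMDiffAt_iff_contDiffAt]
    refine ContMDiffAt.comp (c x) (by rwa [hcx]) ?_
    exact (contMDiffOn_extChartAt_symm x).contMDiffAt (extChartAt_target_mem_nhds x)
  have hψ' : DifferentiableAt ℝ (fderiv ℝ ψ) (c x) :=
    (hψ2.fderiv_right (m := 1) (by rw [one_add_one_eq_two]; exact ENat.LEInfty.out)).differentiableAt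
      (by simp)
  have hmd : ∀ᶠ y in 𝓝 x, MDifferentiableAt 𝓘(ℝ, E) 𝓘(ℝ, G) φ y := by
    have h1 : ContMDiffAt 𝓘(ℝ, E) 𝓘(ℝ, G) 1 φ x := hφ.of_le (by simp)
    filter_upwards [contMDiffAt_iff_contMDiffAt_nhds (by simp) |>.1 h1] with y hy
      using hy.mdifferentiableAt (by simp)
  have hsymm : Filter.Tendsto c.symm (𝓝 (c x)) (𝓝 x) := by
    have := (continuousAt_extChartAt_symm (I := 𝓘(ℝ, E)) x)
    rwa [ContinuousAt, ← hc, hcx] at this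
  -- the derivative of `φ` along a vector field, read in the chart
  have hk (Z : Π y : N, TangentSpace 𝓘(ℝ, E) y) : ∀ᶠ z in 𝓝 (c x),
      fderiv ℝ ψ z (hat Z z) = mvfderiv 𝓘(ℝ, E) φ (c.symm z) (Z (c.symm z)) := by
    filter_upwards [hsymm.eventually hmd, extChartAt_target_mem_nhds (I := 𝓘(ℝ, E)) x]
      with z hz hzt
    have hcs : MDifferentiableAt 𝓘(ℝ, E) 𝓘(ℝ, E) c.symm z :=
      ((contMDiffOn_extChartAt_symm (n := 1) x).contMDiffAt
        (extChartAt_target_mem_nhds' hzt)).mdifferentiableAt (by simp)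
    have h1 : (fderiv ℝ ψ z : E →L[ℝ] G) =
        (mfderiv 𝓘(ℝ, E) 𝓘(ℝ, G) φ (c.symm z)).comp (mfderiv 𝓘(ℝ, E) 𝓘(ℝ, E) c.symm z) := by
      rw [← mfderiv_eq_fderiv]
      exact mfderiv_comp z hz hcs
    have h2 := isInvertible_mfderivWithin_extChartAt_symm (I := 𝓘(ℝ, E)) hzt
    simp only [modelWithCornersSelf_coe, Set.range_id, mfderivWithin_univ] at h2
    rw [h1]
    change (mfderiv 𝓘(ℝ, E) 𝓘(ℝ, G) φ (c.symm z)) ((mfderiv 𝓘(ℝ, E) 𝓘(ℝ, E) c.symm z)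
      (VectorField.mpullbackWithin 𝓘(ℝ, E) 𝓘(ℝ, E) c.symm Z (Set.range 𝓘(ℝ, E)) z)) = _
    rw [VectorField.mpullbackWithin_apply]
    simp only [modelWithCornersSelf_coe, Set.range_id, mfderivWithin_univ]
    rw [h2.self_apply_inverse]
    rfl
  have huniv : c.symm ⁻¹' Set.univ ∩ Set.range 𝓘(ℝ, E) = Set.univ := by simp
  have hhat {Z : Π y : N, TangentSpace 𝓘(ℝ, E) y}
      (hZ : MDifferentiableAt 𝓘(ℝ, E) 𝓘(ℝ, E).tangent
        (fun y ↦ (⟨y, Z y⟩ : TangentBundle 𝓘(ℝ, E) N)) x) : DifferentiableAt ℝ (hat Z) (c x) := by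
    have : DifferentiableWithinAt ℝ (hat Z) (c.symm ⁻¹' Set.univ ∩ Set.range 𝓘(ℝ, E)) (c x) :=
      MDifferentiableWithinAt.differentiableWithinAt_mpullbackWithin_vectorField
        (s := Set.univ) hZ.mdifferentiableWithinAt
    rwa [huniv, differentiableWithinAt_univ] at this
  have hhatx (Z : Π y : N, TangentSpace 𝓘(ℝ, E) y) : hat Z (c x) = Z x := by
    change (mfderivWithin 𝓘(ℝ, E) 𝓘(ℝ, E) c.symm (Set.range 𝓘(ℝ, E)) (c x)).inverse
      (Z (c.symm (c x))) = Z x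
    rw [hcx]
    exact mfderivWithin_extChartAt_symm_inverse_apply (I := 𝓘(ℝ, E)) (Z x)
  have hcd : HasMFDerivAt 𝓘(ℝ, E) 𝓘(ℝ, E) c x (ContinuousLinearMap.id ℝ E) := by
    have := (mdifferentiableAt_extChartAt (I := 𝓘(ℝ, E)) (mem_chart_source E x)).hasMFDerivAt
    rwa [mfderiv_extChartAt_self] at this
  -- Product rule in the chart. After antisymmetrization the Hessian terms cancel, and the terms
  -- with the derivative of `hat Z` assemble into the bracket.
  have hd {Z : Π y : N, TangentSpace 𝓘(ℝ, E) y}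
      (hZ : MDifferentiableAt 𝓘(ℝ, E) 𝓘(ℝ, E).tangent
        (fun y ↦ (⟨y, Z y⟩ : TangentBundle 𝓘(ℝ, E) N)) x) (w : TangentSpace 𝓘(ℝ, E) x) :
      mvfderiv 𝓘(ℝ, E) (fun y ↦ mvfderiv 𝓘(ℝ, E) φ y (Z y)) x w =
        fderiv ℝ (fderiv ℝ ψ) (c x) w (Z x) + fderiv ℝ ψ (c x) (fderiv ℝ (hat Z) (c x) w) := by
    have h1 := (hψ'.hasFDerivAt.clm_apply (hhat hZ).hasFDerivAt).hasMFDerivAt.comp x hcd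
    have h2 : (fun y ↦ mvfderiv 𝓘(ℝ, E) φ y (Z y)) =ᶠ[𝓝 x]
        (fun z ↦ fderiv ℝ ψ z (hat Z z)) ∘ c := by
      filter_upwards [(continuousAt_extChartAt (I := 𝓘(ℝ, E)) x).eventually (hk Z),
        extChartAt_source_mem_nhds (I := 𝓘(ℝ, E)) x] with y hy hys
      rw [Function.comp_apply, hy, c.left_inv hys]
    rw [mvfderiv_congr h2, mvfderiv_eq_of_hasMFDerivAt h1]
    simp [hhatx, add_comm]
    rfl
  have hsym : IsSymmSndFDerivAt ℝ ψ (c x) :=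
    hψ2.isSymmSndFDerivAt (by
      rw [minSmoothness_of_isRCLikeNormedField]; exact ENat.LEInfty.out)
  have hbr : (VectorField.mlieBracket 𝓘(ℝ, E) X Y x : E) =
      VectorField.lieBracket ℝ (hat X) (hat Y) (c x) := by
    -- The chart at `x` has identity derivative at `x`, so the bracket there needs no transport
    -- back.
    let m : E →L[ℝ] E := mfderiv 𝓘(ℝ, E) 𝓘(ℝ, E) c x
    have hm : m = ContinuousLinearMap.id ℝ E := mfderiv_extChartAt_self
    change m.inverse (VectorField.lieBracketWithin ℝ (hat X) (hat Y)
      (c.symm ⁻¹' Set.univ ∩ Set.range 𝓘(ℝ, E)) (c x)) = _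
    rw [hm, ContinuousLinearMap.inverse_id, huniv, VectorField.lieBracketWithin_univ]
    rfl
  have hψφ (w : E) : mvfderiv 𝓘(ℝ, E) φ x w = fderiv ℝ ψ (c x) w := by
    have h1 : HasMFDerivAt 𝓘(ℝ, E) 𝓘(ℝ, G) (ψ ∘ c) x _ :=
      (hψ2.differentiableAt (by simp)).hasFDerivAt.hasMFDerivAt.comp x hcd
    have h2 : φ =ᶠ[𝓝 x] ψ ∘ c := by
      filter_upwards [extChartAt_source_mem_nhds (I := 𝓘(ℝ, E)) x] with y hys
      simp only [hψ, Function.comp_apply]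
      rw [c.left_inv hys]
    rw [mvfderiv_congr h2, mvfderiv_eq_of_hasMFDerivAt h1]
    rfl
  rw [hd hX, hd hY]
  refine Eq.trans ?_ (hψφ _).symm
  rw [hbr, VectorField.lieBracket_eq]
  simp only [map_sub, hhatx]
  rw [hsym (X x) (Y x)]
  abel

end VectorValued

/-! ### Tangent vectors in a fixed trivialization -/

section Frame

variable {F : Type*} [NormedAddCommGroup F] [NormedSpace ℝ F]
  {M : Type*} [TopologicalSpace M] [ChartedSpace F M] [IsManifold 𝓘(ℝ, F) ∞ M]

/-- The inverse at `q` of the trivialization of `TM` at `p`. -/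
noncomputable def frame (p q : M) : F →L[ℝ] TangentSpace 𝓘(ℝ, F) q :=
  (trivializationAt F (TangentSpace 𝓘(ℝ, F) : M → Type _) p).symmL ℝ q

/-- The trivialization of `TM` at `p`, on the tangent space at `q`. -/
noncomputable def coframe (p q : M) : TangentSpace 𝓘(ℝ, F) q →L[ℝ] F :=
  (trivializationAt F (TangentSpace 𝓘(ℝ, F) : M → Type _) p).continuousLinearMapAt ℝ q

theorem eventually_mem_baseSet (p : M) : ∀ᶠ q in 𝓝 p,
    q ∈ (trivializationAt F (TangentSpace 𝓘(ℝ, F) : M → Type _) p).baseSet :=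
  (trivializationAt F (TangentSpace 𝓘(ℝ, F) : M → Type _) p).open_baseSet.mem_nhds
    (FiberBundle.mem_baseSet_trivializationAt' p)

theorem coframe_apply {p q : M}
    (hq : q ∈ (trivializationAt F (TangentSpace 𝓘(ℝ, F) : M → Type _) p).baseSet)
    (v : TangentSpace 𝓘(ℝ, F) q) :
    coframe p q v = (trivializationAt F (TangentSpace 𝓘(ℝ, F) : M → Type _) p ⟨q, v⟩).2 :=
  congrFun (Trivialization.coe_linearMapAt_of_mem (R := ℝ) _ hq) v

theorem coframe_frame {p q : M}
    (hq : q ∈ (trivializationAt F (TangentSpace 𝓘(ℝ, F) : M → Type _) p).baseSet) (a : F) :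
    coframe p q (frame p q a) = a :=
  Trivialization.continuousLinearMapAt_symmL _ hq a

theorem frame_coframe {p q : M}
    (hq : q ∈ (trivializationAt F (TangentSpace 𝓘(ℝ, F) : M → Type _) p).baseSet)
    (v : TangentSpace 𝓘(ℝ, F) q) : frame p q (coframe p q v) = v :=
  Trivialization.symmL_continuousLinearMapAt _ hq v

theorem frame_coframe_self (p : M) (v : TangentSpace 𝓘(ℝ, F) p) :
    frame p p (coframe p p v) = v :=
  frame_coframe (FiberBundle.mem_baseSet_trivializationAt' p) v

theorem extend_eq_frame {p q : M}
    (hq : q ∈ (trivializationAt F (TangentSpace 𝓘(ℝ, F) : M → Type _) p).baseSet)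
    (v : TangentSpace 𝓘(ℝ, F) p) :
    FiberBundle.extend F v q = frame p q (coframe p p v) := by
  rw [coframe_apply (FiberBundle.mem_baseSet_trivializationAt' p)]
  exact (Trivialization.symmL_apply _ hq _).symm

theorem coframe_extend {p q : M}
    (hq : q ∈ (trivializationAt F (TangentSpace 𝓘(ℝ, F) : M → Type _) p).baseSet)
    (v : TangentSpace 𝓘(ℝ, F) p) :
    coframe p q (FiberBundle.extend F v q) = coframe p p v := by
  rw [extend_eq_frame hq, coframe_frame hq]

/-- Lets sections along `f` be treated as `F`-valued functions: the base map is already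
differentiable, so only the fibre coordinate matters. -/
theorem mdifferentiableAt_coframe_iff {E : Type*} [NormedAddCommGroup E] [NormedSpace ℝ E]
    {N : Type*} [TopologicalSpace N] [ChartedSpace E N] {f : N → M} {x : N}
    (hf : MDifferentiableAt 𝓘(ℝ, E) 𝓘(ℝ, F) f x)
    (V : Π y : N, TangentSpace 𝓘(ℝ, F) (f y)) :
    MDifferentiableAt 𝓘(ℝ, E) 𝓘(ℝ, F).tangent
        (fun y ↦ (⟨f y, V y⟩ : TangentBundle 𝓘(ℝ, F) M)) x ↔
      MDifferentiableAt 𝓘(ℝ, E) 𝓘(ℝ, F) (fun y ↦ coframe (f x) (f y) (V y)) x := by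
  have : IsManifold 𝓘(ℝ, F) 1 M := .of_le (n := ∞) (by simp)
  have h : (fun y ↦ coframe (f x) (f y) (V y)) =ᶠ[𝓝 x] fun y ↦
      (trivializationAt F (TangentSpace 𝓘(ℝ, F) : M → Type _) (f x) ⟨f y, V y⟩).2 := by
    filter_upwards [hf.continuousAt.eventually (eventually_mem_baseSet (F := F) (f x))] with y hy
    exact coframe_apply hy _
  rw [h.mdifferentiableAt_iff]
  refine (mdifferentiableAt_totalSpace _ (fun y ↦ (⟨f y, V y⟩ : TangentBundle 𝓘(ℝ, F) M))).trans
    ⟨fun h ↦ h.2, fun h ↦ ⟨hf, h⟩⟩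

theorem mdifferentiableAt_section_iff_coframe {p : M} (Y : Π q : M, TangentSpace 𝓘(ℝ, F) q) :
    MDifferentiableAt 𝓘(ℝ, F) 𝓘(ℝ, F).tangent
        (fun q ↦ (⟨q, Y q⟩ : TangentBundle 𝓘(ℝ, F) M)) p ↔
      MDifferentiableAt 𝓘(ℝ, F) 𝓘(ℝ, F) (fun q ↦ coframe p q (Y q)) p :=
  mdifferentiableAt_coframe_iff (f := id) mdifferentiableAt_id Y

theorem mdifferentiableAt_extend' {p : M} (v : TangentSpace 𝓘(ℝ, F) p) :
    MDifferentiableAt 𝓘(ℝ, F) 𝓘(ℝ, F).tangent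
      (fun q ↦ (⟨q, FiberBundle.extend F v q⟩ : TangentBundle 𝓘(ℝ, F) M)) p := by
  have : IsManifold 𝓘(ℝ, F) 1 M := .of_le (n := ∞) (by simp)
  exact FiberBundle.mdifferentiableAt_extend 𝓘(ℝ, F) F v

end Frame

/-! ### A connection as flat derivative plus Christoffel term -/

section Connection

variable {F : Type*} [NormedAddCommGroup F] [NormedSpace ℝ F]
  {M : Type*} [TopologicalSpace M] [ChartedSpace F M] [IsManifold 𝓘(ℝ, F) ∞ M]
  {D : CovariantDerivative 𝓘(ℝ, F) F (TangentSpace 𝓘(ℝ, F) : M → Type _)}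

variable (F) in
/-- The trivialization of `TM` at `p` induces a flat connection. -/
theorem isCovariantDerivativeOn_flat (p : M) :
    IsCovariantDerivativeOn (I := 𝓘(ℝ, F)) F (V := (TangentSpace 𝓘(ℝ, F) : M → Type _))
      (fun Y q ↦ (frame p q).comp (mvfderiv 𝓘(ℝ, F) (fun q' ↦ coframe p q' (Y q')) q)) {p} where
  add {Y Z q} hY hZ hq := by
    obtain rfl : q = p := hq
    rw [mdifferentiableAt_section_iff_coframe] at hY hZ
    rw [← ContinuousLinearMap.comp_add, ← mvfderiv_add hY hZ]
    congr 2
    ext q'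
    simp
  leibniz {Y a q} hY ha hq := by
    obtain rfl : q = p := hq
    rw [mdifferentiableAt_section_iff_coframe] at hY
    have : (fun q' ↦ coframe q q' ((a • Y) q')) = a • fun q' ↦ coframe q q' (Y q') := by
      ext q'
      simp
    rw [this, mvfderiv_smul ha hY]
    ext v
    simp [frame_coframe_self]

/-- A connection in the trivialization at `p`. -/
theorem cov_eq_frame_add [FiniteDimensional ℝ F] {p : M} {Y : Π q : M, TangentSpace 𝓘(ℝ, F) q}
    (hY : MDifferentiableAt 𝓘(ℝ, F) 𝓘(ℝ, F).tangent
      (fun q ↦ (⟨q, Y q⟩ : TangentBundle 𝓘(ℝ, F) M)) p) (v : TangentSpace 𝓘(ℝ, F) p) :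
    D Y p v = frame p p (mvfderiv 𝓘(ℝ, F) (fun q ↦ coframe p q (Y q)) p v)
      + D (FiberBundle.extend F (Y p)) p v := by
  have : IsManifold 𝓘(ℝ, F) 1 M := .of_le (n := ∞) (by simp)
  have : ContMDiffVectorBundle 1 F (TangentSpace 𝓘(ℝ, F) : M → Type _) 𝓘(ℝ, F) :=
    TangentBundle.contMDiffVectorBundle (h := .of_le (n := ∞) (by
      rw [one_add_one_eq_two]; exact ENat.LEInfty.out))
  -- The difference of two connections is a tensor, so it may be evaluated on the extension of `Y p`
  -- instead of `Y`; that extension has constant coordinates near `p`, and its flat derivative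
  -- vanishes.
  have h1 := IsCovariantDerivativeOn.difference_apply (s := {p})
    D.isCovariantDerivativeOn (isCovariantDerivativeOn_flat F p) (x := p) rfl hY
  have h2 := IsCovariantDerivativeOn.difference_apply (s := {p})
    D.isCovariantDerivativeOn (isCovariantDerivativeOn_flat F p) (x := p) rfl
    (mdifferentiableAt_extend' (Y p))
  have h3 : (fun q ↦ coframe p q (FiberBundle.extend F (Y p) q)) =ᶠ[𝓝 p]
      fun _ ↦ coframe p p (Y p) := by
    filter_upwards [eventually_mem_baseSet (F := F) p] with q hq using coframe_extend hq _
  rw [FiberBundle.extend_apply_self, h1] at h2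
  have h4 := congr($h2 v)
  simp only [sub_apply, ContinuousLinearMap.comp_apply] at h4
  rw [mvfderiv_congr h3, mvfderiv_const] at h4
  simp only [zero_apply, map_zero, sub_zero] at h4
  rw [← h4]
  abel

end Connection

/-! ### Components of the metric and of the Golden structure -/

section TensorsInFrames

variable {F : Type*} [NormedAddCommGroup F] [NormedSpace ℝ F]
  {M : Type*} [TopologicalSpace M] [ChartedSpace F M] [IsManifold 𝓘(ℝ, F) ∞ M]

/-- The components of `g` in the trivialization of `TM` at `p` vary differentiably. -/
theorem SemiRiemannianMetric.exists_components (g : SemiRiemannianMetric F M) (p : M) :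
    ∃ G : M → F →L[ℝ] F →L[ℝ] ℝ,
      MDifferentiableAt 𝓘(ℝ, F) 𝓘(ℝ, F →L[ℝ] F →L[ℝ] ℝ) G p ∧
      ∀ᶠ q in 𝓝 p, ∀ v w : TangentSpace 𝓘(ℝ, F) q,
        G q (coframe p q v) (coframe p q w) = g.val q v w := by
  have : IsManifold 𝓘(ℝ, F) 1 M := .of_le (n := ∞) (by simp)
  -- The witness is the coordinate form of `g` in which smoothness of a section of a hom bundle is
  -- expressed.
  refine ⟨_, (((contMDiffAt_hom_bundle _).1 (g.contMDiff p)).2.mdifferentiableAt (by simp)), ?_⟩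
  filter_upwards [eventually_mem_baseSet (F := F) p] with q hq v w
  refine (inCoordinates_apply_eq₂ hq hq (by simp)).trans ?_
  have h (v : TangentSpace 𝓘(ℝ, F) q) :
      (trivializationAt F (TangentSpace 𝓘(ℝ, F) : M → Type _) p).symm q (coframe p q v) = v := by
    rw [← Trivialization.symmL_apply (R := ℝ) _ hq]
    exact frame_coframe hq v
  rw [h, h]
  simp

/-- The components of `P` in the trivialization of `TM` at `p` vary differentiably. -/
theorem GoldenStructure.exists_components {g : SemiRiemannianMetric F M} (P : GoldenStructure g)
    (p : M) :
    ∃ Q : M → F →L[ℝ] F, MDifferentiableAt 𝓘(ℝ, F) 𝓘(ℝ, F →L[ℝ] F) Q p ∧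
      ∀ᶠ q in 𝓝 p, ∀ v : TangentSpace 𝓘(ℝ, F) q,
        Q q (coframe p q v) = coframe p q (P.toFun q v) := by
  have : IsManifold 𝓘(ℝ, F) 1 M := .of_le (n := ∞) (by simp)
  refine ⟨_, (((contMDiffAt_hom_bundle _).1 (P.contMDiff p)).2.mdifferentiableAt (by simp)), ?_⟩
  filter_upwards [eventually_mem_baseSet (F := F) p] with q hq v
  change coframe p q (P.toFun q (frame p q (coframe p q v))) = _
  rw [frame_coframe hq]

theorem mdifferentiableAt_clm_apply {E G G' : Type*} [NormedAddCommGroup E] [NormedSpace ℝ E]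
    [NormedAddCommGroup G] [NormedSpace ℝ G] [NormedAddCommGroup G'] [NormedSpace ℝ G']
    {N : Type*} [TopologicalSpace N] [ChartedSpace E N]
    {Φ : N → G →L[ℝ] G'} {v : N → G} {x : N}
    (hΦ : MDifferentiableAt 𝓘(ℝ, E) 𝓘(ℝ, G →L[ℝ] G') Φ x)
    (hv : MDifferentiableAt 𝓘(ℝ, E) 𝓘(ℝ, G) v x) :
    MDifferentiableAt 𝓘(ℝ, E) 𝓘(ℝ, G') (fun y ↦ Φ y (v y)) x :=
  hΦ.clm_apply hv

end TensorsInFrames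

/-! ### The pullback connection: metricity and parallelism -/

section Along

variable {E : Type*} [NormedAddCommGroup E] [NormedSpace ℝ E]
  {N : Type*} [TopologicalSpace N] [ChartedSpace E N]
  {F : Type*} [NormedAddCommGroup F] [NormedSpace ℝ F]
  {M : Type*} [TopologicalSpace M] [ChartedSpace F M] [IsManifold 𝓘(ℝ, F) ∞ M]
  {g : SemiRiemannianMetric F M}
  {D : CovariantDerivative 𝓘(ℝ, F) F (TangentSpace 𝓘(ℝ, F) : M → Type _)}
  {f : N → M} {x : N}

/-- `coframe` agrees with the raw fibre coordinate only over the base set of the trivialization;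
continuity of `f` keeps nearby points there. -/
theorem covAlong_apply (hf : ContinuousAt f x) (V : Π y : N, TangentSpace 𝓘(ℝ, F) (f y))
    (w : TangentSpace 𝓘(ℝ, E) x) :
    covAlong D f V x w =
      frame (f x) (f x) (mvfderiv 𝓘(ℝ, E) (fun y ↦ coframe (f x) (f y) (V y)) x w)
        + D (FiberBundle.extend F (V x)) (f x) (diff f x w) := by
  have h : (fun y ↦ coframe (f x) (f y) (V y)) =ᶠ[𝓝 x] fun y ↦
      (trivializationAt F (TangentSpace 𝓘(ℝ, F) : M → Type _) (f x) ⟨f y, V y⟩).2 := by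
    filter_upwards [hf.eventually (eventually_mem_baseSet (F := F) (f x))] with y hy
    exact coframe_apply hy _
  rw [mvfderiv_congr h]
  rfl

/-- The pullback connection is compatible with the metric. -/
theorem IsLeviCivita.mvfderiv_along [FiniteDimensional ℝ F] (hD : IsLeviCivita g D)
    (hf : MDifferentiableAt 𝓘(ℝ, E) 𝓘(ℝ, F) f x)
    {V W : Π y : N, TangentSpace 𝓘(ℝ, F) (f y)}
    (hV : MDifferentiableAt 𝓘(ℝ, E) 𝓘(ℝ, F).tangent
      (fun y ↦ (⟨f y, V y⟩ : TangentBundle 𝓘(ℝ, F) M)) x)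
    (hW : MDifferentiableAt 𝓘(ℝ, E) 𝓘(ℝ, F).tangent
      (fun y ↦ (⟨f y, W y⟩ : TangentBundle 𝓘(ℝ, F) M)) x) (w : TangentSpace 𝓘(ℝ, E) x) :
    mvfderiv 𝓘(ℝ, E) (fun y ↦ g.val (f y) (V y) (W y)) x w =
      g.val (f x) (covAlong D f V x w) (W x) + g.val (f x) (V x) (covAlong D f W x w) := by
  obtain ⟨G, hG, hGg⟩ := g.exists_components (f x)
  rw [mdifferentiableAt_coframe_iff hf] at hV hW
  have hGf : MDifferentiableAt 𝓘(ℝ, E) 𝓘(ℝ, F →L[ℝ] F →L[ℝ] ℝ) (fun y ↦ G (f y)) x :=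
    MDifferentiableAt.comp x hG hf
  have h1 : (fun y ↦ g.val (f y) (V y) (W y)) =ᶠ[𝓝 x]
      fun y ↦ G (f y) (coframe (f x) (f y) (V y)) (coframe (f x) (f y) (W y)) := by
    filter_upwards [hf.continuousAt.eventually hGg] with y hy using (hy _ _).symm
  have h2 : (fun q ↦ g.val q (FiberBundle.extend F (V x) q) (FiberBundle.extend F (W x) q))
      =ᶠ[𝓝 (f x)] fun q ↦ G q (coframe (f x) (f x) (V x)) (coframe (f x) (f x) (W x)) := by
    filter_upwards [hGg, eventually_mem_baseSet (F := F) (f x)] with q hq hqb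
    rw [← hq, coframe_extend hqb, coframe_extend hqb]
  -- On fields with constant coordinates, metricity expresses the derivative of `G` through the two
  -- Christoffel terms. The other Leibniz terms are the coordinate derivatives of `V` and `W`.
  have h3 := hD.metric (f x) _ _ (mdifferentiableAt_extend' (V x)) (mdifferentiableAt_extend' (W x))
    (diff f x w)
  have hGx (v v' : TangentSpace 𝓘(ℝ, F) (f x)) := hGg.self_of_nhds v v'
  have hFr (a : F) : coframe (f x) (f x) (frame (f x) (f x) a) = a :=
    coframe_frame (FiberBundle.mem_baseSet_trivializationAt' (f x)) a
  rw [mvfderiv_congr h2, mvfderiv_clm_apply (mdifferentiableAt_clm_apply hG mdifferentiableAt_const)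
    mdifferentiableAt_const, mvfderiv_clm_apply hG mdifferentiableAt_const] at h3
  simp only [mvfderiv_const, zero_apply, map_zero, add_zero, FiberBundle.extend_apply_self] at h3
  rw [mvfderiv_congr h1, mvfderiv_clm_apply (mdifferentiableAt_clm_apply hGf hV) hW,
    mvfderiv_clm_apply hGf hV, mvfderiv_comp_diff hG hf, covAlong_apply hf.continuousAt,
    covAlong_apply hf.continuousAt]
  simp only [add_apply, map_add, h3]
  rw [← hGx (frame _ _ _), ← hGx _ (frame _ _ _), hFr, hFr]
  ring

/-- A locally Golden structure is parallel for the pullback connection. -/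
theorem GoldenStructure.IsLocallyGolden.covAlong [FiniteDimensional ℝ F]
    {P : GoldenStructure g} (hP : P.IsLocallyGolden D) (hf : MDifferentiableAt 𝓘(ℝ, E) 𝓘(ℝ, F) f x)
    {V : Π y : N, TangentSpace 𝓘(ℝ, F) (f y)}
    (hV : MDifferentiableAt 𝓘(ℝ, E) 𝓘(ℝ, F).tangent
      (fun y ↦ (⟨f y, V y⟩ : TangentBundle 𝓘(ℝ, F) M)) x) (w : TangentSpace 𝓘(ℝ, E) x) :
    covAlong D f (fun y ↦ P.toFun (f y) (V y)) x w = P.toFun (f x) (covAlong D f V x w) := by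
  obtain ⟨Q, hQ, hQP⟩ := P.exists_components (f x)
  rw [mdifferentiableAt_coframe_iff hf] at hV
  have hQf : MDifferentiableAt 𝓘(ℝ, E) 𝓘(ℝ, F →L[ℝ] F) (fun y ↦ Q (f y)) x :=
    MDifferentiableAt.comp x hQ hf
  have h1 : (fun y ↦ coframe (f x) (f y) (P.toFun (f y) (V y))) =ᶠ[𝓝 x]
      fun y ↦ Q (f y) (coframe (f x) (f y) (V y)) := by
    filter_upwards [hf.continuousAt.eventually hQP] with y hy using (hy _).symm
  have h2 : (fun q ↦ coframe (f x) q (P.toFun q (FiberBundle.extend F (V x) q)))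
      =ᶠ[𝓝 (f x)] fun q ↦ Q q (coframe (f x) (f x) (V x)) := by
    filter_upwards [hQP, eventually_mem_baseSet (F := F) (f x)] with q hq hqb
    rw [← hq, coframe_extend hqb]
  -- On a field with constant coordinates, parallelism expresses the derivative of `Q` as the
  -- commutator of `P` with the Christoffel term.
  have h3 := hP (f x) _ (mdifferentiableAt_extend' (V x)) (diff f x w)
  have hPV : MDifferentiableAt 𝓘(ℝ, F) 𝓘(ℝ, F).tangent
      (fun q ↦ (⟨q, P.toFun q (FiberBundle.extend F (V x) q)⟩ : TangentBundle 𝓘(ℝ, F) M))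
      (f x) := by
    rw [mdifferentiableAt_section_iff_coframe, h2.mdifferentiableAt_iff]
    exact mdifferentiableAt_clm_apply hQ mdifferentiableAt_const
  rw [cov_eq_frame_add hPV, mvfderiv_congr h2, mvfderiv_clm_apply hQ mdifferentiableAt_const]
    at h3
  simp only [mvfderiv_const, zero_apply, map_zero, add_zero, FiberBundle.extend_apply_self] at h3
  have hPf (a : F) : P.toFun (f x) (frame (f x) (f x) a) = frame (f x) (f x) (Q (f x) a) := by
    have := hQP.self_of_nhds (frame (f x) (f x) a)
    rw [coframe_frame (FiberBundle.mem_baseSet_trivializationAt' (f x))] at this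
    rw [this, frame_coframe_self]
  rw [covAlong_apply hf.continuousAt, covAlong_apply hf.continuousAt, mvfderiv_congr h1,
    mvfderiv_clm_apply hQf hV, mvfderiv_comp_diff hQ hf, map_add, map_add, ← h3, hPf]
  abel

end Along

/-! ### The pullback connection: vanishing torsion -/

section Torsion

variable {E : Type*} [NormedAddCommGroup E] [NormedSpace ℝ E]
  {N : Type*} [TopologicalSpace N] [ChartedSpace E N] [IsManifold 𝓘(ℝ, E) ∞ N]
  {F : Type*} [NormedAddCommGroup F] [NormedSpace ℝ F]
  {M : Type*} [TopologicalSpace M] [ChartedSpace F M] [IsManifold 𝓘(ℝ, F) ∞ M]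
  {g : SemiRiemannianMetric F M}
  {D : CovariantDerivative 𝓘(ℝ, F) F (TangentSpace 𝓘(ℝ, F) : M → Type _)}
  {f : N → M} {x : N} {U : Π y : N, TangentSpace 𝓘(ℝ, E) y}

theorem coframe_eq_mvfderiv {p q : M} (hq : q ∈ (chartAt F p).source)
    (v : TangentSpace 𝓘(ℝ, F) q) :
    coframe p q v = mvfderiv 𝓘(ℝ, F) (extChartAt 𝓘(ℝ, F) p) q v := by
  have : IsManifold 𝓘(ℝ, F) 1 M := .of_le (n := ∞) (by simp)
  exact congrArg (fun A : TangentSpace 𝓘(ℝ, F) q →L[ℝ] F ↦ A v)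
    (TangentBundle.continuousLinearMapAt_trivializationAt (I := 𝓘(ℝ, F)) hq)

/-- Fields with constant coordinates commute: apply the symmetry of second derivatives to the chart
itself, whose derivatives along both fields are locally constant. -/
theorem mlieBracket_extend [FiniteDimensional ℝ F] {p : M}
    (a b : TangentSpace 𝓘(ℝ, F) p) :
    VectorField.mlieBracket 𝓘(ℝ, F) (FiberBundle.extend F a) (FiberBundle.extend F b) p = 0 := by
  have hconst (c : TangentSpace 𝓘(ℝ, F) p) :
      (fun q ↦ mvfderiv 𝓘(ℝ, F) (extChartAt 𝓘(ℝ, F) p) q (FiberBundle.extend F c q)) =ᶠ[𝓝 p]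
        fun _ ↦ coframe p p c := by
    filter_upwards [eventually_mem_baseSet (F := F) p, chart_source_mem_nhds F p] with q hq hq'
    rw [← coframe_eq_mvfderiv hq', coframe_extend hq]
  have h := mvfderiv_mvfderiv_sub (contMDiffAt_extChartAt (I := 𝓘(ℝ, F)) (n := ∞) (x := p))
    (mdifferentiableAt_extend' a) (mdifferentiableAt_extend' b)
  rw [mvfderiv_congr (hconst a), mvfderiv_congr (hconst b), mvfderiv_const, mvfderiv_const,
    ← coframe_eq_mvfderiv (mem_chart_source F p)] at h
  rw [← frame_coframe_self p (VectorField.mlieBracket _ _ _ _), ← h]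
  simp

/-- Symmetry of the Christoffel symbols, from zero torsion applied to two commuting fields. -/
theorem IsLeviCivita.cov_extend_comm [FiniteDimensional ℝ F] (hD : IsLeviCivita g D)
    {p : M} (a b : TangentSpace 𝓘(ℝ, F) p) :
    D (FiberBundle.extend F a) p b = D (FiberBundle.extend F b) p a := by
  have h := (D.torsion_eq_zero_iff.1 hD.torsion_eq_zero) (mdifferentiableAt_extend' b)
    (mdifferentiableAt_extend' a)
  rw [mlieBracket_extend, FiberBundle.extend_apply_self, FiberBundle.extend_apply_self] at h
  exact sub_eq_zero.1 h

theorem mdifferentiableAt_diff_apply (hf : ContMDiff 𝓘(ℝ, E) 𝓘(ℝ, F) ∞ f)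
    {X : Π y : N, TangentSpace 𝓘(ℝ, E) y}
    (hX : MDifferentiableAt 𝓘(ℝ, E) 𝓘(ℝ, E).tangent
      (fun y ↦ (⟨y, X y⟩ : TangentBundle 𝓘(ℝ, E) N)) x) :
    MDifferentiableAt 𝓘(ℝ, E) 𝓘(ℝ, F).tangent
      (fun y ↦ (⟨f y, diff f y (X y)⟩ : TangentBundle 𝓘(ℝ, F) M)) x := by
  have : IsManifold 𝓘(ℝ, E) 1 N := .of_le (n := ∞) (by simp)
  have : IsManifold 𝓘(ℝ, F) 1 M := .of_le (n := ∞) (by simp)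
  have h : ContMDiff 𝓘(ℝ, E).tangent 𝓘(ℝ, F).tangent 1 (tangentMap 𝓘(ℝ, E) 𝓘(ℝ, F) f) :=
    hf.contMDiff_tangentMap (by rw [one_add_one_eq_two]; exact ENat.LEInfty.out)
  exact (h.mdifferentiable (by simp) _).comp x hX

theorem IsSmoothSection.mdifferentiableAt
    {B : Π x : N, Submodule ℝ (TangentSpace 𝓘(ℝ, E) x)} (hU : IsSmoothSection B U) (x : N) :
    MDifferentiableAt 𝓘(ℝ, E) 𝓘(ℝ, E).tangent
      (fun y ↦ (⟨y, U y⟩ : TangentBundle 𝓘(ℝ, E) N)) x :=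
  hU.1.mdifferentiable (by simp) x

theorem GoldenStructure.mdifferentiableAt_apply_diff (P : GoldenStructure g)
    (hf : ContMDiff 𝓘(ℝ, E) 𝓘(ℝ, F) ∞ f)
    (hU : MDifferentiableAt 𝓘(ℝ, E) 𝓘(ℝ, E).tangent
      (fun y ↦ (⟨y, U y⟩ : TangentBundle 𝓘(ℝ, E) N)) x) :
    MDifferentiableAt 𝓘(ℝ, E) 𝓘(ℝ, F).tangent
      (fun y ↦ (⟨f y, P.toFun (f y) (diff f y (U y))⟩ : TangentBundle 𝓘(ℝ, F) M)) x := by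
  have hfx : MDifferentiableAt 𝓘(ℝ, E) 𝓘(ℝ, F) f x := hf.mdifferentiable (by simp) x
  have hV := (mdifferentiableAt_coframe_iff hfx _).1 (mdifferentiableAt_diff_apply hf hU)
  obtain ⟨Q, hQ, hQP⟩ := P.exists_components (f x)
  rw [mdifferentiableAt_coframe_iff hfx]
  refine (mdifferentiableAt_clm_apply (hQ.comp x hfx) hV).congr_of_eventuallyEq ?_
  filter_upwards [hfx.continuousAt.eventually hQP] with y hy using (hy _).symm

/-- The pullback of a torsion-free connection:
`D_X (df Y) - D_Y (df X) = df [X, Y]`. -/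
theorem IsLeviCivita.covAlong_diff_sub [FiniteDimensional ℝ E] [FiniteDimensional ℝ F]
    (hD : IsLeviCivita g D)
    (hf : ContMDiff 𝓘(ℝ, E) 𝓘(ℝ, F) ∞ f) {X Y : Π y : N, TangentSpace 𝓘(ℝ, E) y}
    (hX : MDifferentiableAt 𝓘(ℝ, E) 𝓘(ℝ, E).tangent
      (fun y ↦ (⟨y, X y⟩ : TangentBundle 𝓘(ℝ, E) N)) x)
    (hY : MDifferentiableAt 𝓘(ℝ, E) 𝓘(ℝ, E).tangent
      (fun y ↦ (⟨y, Y y⟩ : TangentBundle 𝓘(ℝ, E) N)) x) :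
    covAlong D f (fun y ↦ diff f y (Y y)) x (X x) - covAlong D f (fun y ↦ diff f y (X y)) x (Y x) =
      diff f x (VectorField.mlieBracket 𝓘(ℝ, E) X Y x) := by
  have hmd : MDifferentiable 𝓘(ℝ, E) 𝓘(ℝ, F) f := hf.mdifferentiable (by simp)
  set φ : N → F := fun y ↦ extChartAt 𝓘(ℝ, F) (f x) (f y)
  have hφ : ContMDiffAt 𝓘(ℝ, E) 𝓘(ℝ, F) ∞ φ x := contMDiffAt_extChartAt.comp x (hf x)
  have hco : ∀ᶠ y in 𝓝 x, ∀ v : TangentSpace 𝓘(ℝ, E) y,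
      coframe (f x) (f y) (diff f y v) = mvfderiv 𝓘(ℝ, E) φ y v := by
    filter_upwards [(hf x).continuousAt.eventually (chart_source_mem_nhds F (f x))] with y hy v
    rw [coframe_eq_mvfderiv hy]
    have : IsManifold 𝓘(ℝ, F) 1 M := .of_le (n := ∞) (by simp)
    exact (mvfderiv_comp_diff (mdifferentiableAt_extChartAt hy) (hmd y) v).symm
  have hco' (Z : Π y : N, TangentSpace 𝓘(ℝ, E) y) :
      (fun y ↦ coframe (f x) (f y) (diff f y (Z y))) =ᶠ[𝓝 x]
        fun y ↦ mvfderiv 𝓘(ℝ, E) φ y (Z y) := by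
    filter_upwards [hco] with y hy using hy _
  -- For the coordinate expression `φ` of `f`, this is the derivative part of the claim; the
  -- Christoffel parts cancel by symmetry.
  have h := mvfderiv_mvfderiv_sub hφ hX hY
  rw [← hco.self_of_nhds, ← mvfderiv_congr (hco' X), ← mvfderiv_congr (hco' Y)] at h
  rw [covAlong_apply (hf x).continuousAt, covAlong_apply (hf x).continuousAt,
    hD.cov_extend_comm (diff f x (Y x)), add_sub_add_right_eq_sub, ← map_sub, h,
    frame_coframe_self]

end Torsion

/-! ### Tangential and radical projections -/

namespace LightlikeSubmanifold

variable {E : Type*} [NormedAddCommGroup E] [NormedSpace ℝ E]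
  {N : Type*} [TopologicalSpace N] [ChartedSpace E N] [IsManifold 𝓘(ℝ, E) ∞ N]
  {F : Type*} [NormedAddCommGroup F] [NormedSpace ℝ F]
  {M : Type*} [TopologicalSpace M] [ChartedSpace F M] [IsManifold 𝓘(ℝ, F) ∞ M]
  {g : SemiRiemannianMetric F M} {P : GoldenStructure g}
  {f : N → M} {r : ℕ} (L : LightlikeSubmanifold (E := E) g f r) {x : N}

theorem diff_tangentPart (v : TangentSpace 𝓘(ℝ, F) (f x)) :
    diff f x (L.tangentPart x v) =
      (tangentImage (E := E) f x).projection (L.ltr x ⊔ L.screenTr x) (L.isCompl_tr x) v :=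
  congrArg Subtype.val (LinearEquiv.apply_symm_apply
    (LinearEquiv.ofInjective (diff (E := E) (F := F) f x).toLinearMap (L.injective_diff x)) _)

theorem tangentPart_sub (v w : TangentSpace 𝓘(ℝ, F) (f x)) :
    L.tangentPart x (v - w) = L.tangentPart x v - L.tangentPart x w :=
  L.injective_diff x (by simp only [diff_tangentPart, map_sub])

theorem tangentPart_diff (t : TangentSpace 𝓘(ℝ, E) x) : L.tangentPart x (diff f x t) = t :=
  L.injective_diff x <| (L.diff_tangentPart _).trans <|
    Submodule.projection_apply_of_mem_left (L.isCompl_tr x) ⟨t, rfl⟩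

theorem sub_diff_tangentPart_mem (v : TangentSpace 𝓘(ℝ, F) (f x)) :
    v - diff f x (L.tangentPart x v) ∈ L.ltr x ⊔ L.screenTr x := by
  rw [← Submodule.projection_apply_eq_zero_iff (L.isCompl_tr x), map_sub, diff_tangentPart,
    Submodule.projection_apply_of_mem_left _ (Submodule.projection_apply_mem _ _), sub_self]

theorem radicalPart_eq_zero_iff (t : TangentSpace 𝓘(ℝ, E) x) :
    L.radicalPart x t = 0 ↔ t ∈ L.screen x :=
  Submodule.projection_apply_eq_zero_iff _

theorem radicalPart_mem (t : TangentSpace 𝓘(ℝ, E) x) :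
    L.radicalPart x t ∈ radical (E := E) g f x :=
  Submodule.projection_apply_mem _ _

theorem sub_radicalPart_mem (t : TangentSpace 𝓘(ℝ, E) x) : t - L.radicalPart x t ∈ L.screen x := by
  rw [← L.radicalPart_eq_zero_iff, radicalPart, map_sub, radicalPart,
    Submodule.projection_apply_of_mem_left _ (Submodule.projection_apply_mem _ _), sub_self]

theorem val_screenTr_diff {z : TangentSpace 𝓘(ℝ, F) (f x)} (hz : z ∈ L.screenTr x)
    (t : TangentSpace 𝓘(ℝ, E) x) : g.val (f x) z (diff f x t) = 0 := by
  have : z ∈ normalSpace (E := E) g f x := L.sup_screenTr x ▸ Submodule.mem_sup_right hz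
  exact this t


end LightlikeSubmanifold

namespace LightlikeSubmanifold

namespace IsTransversal

/-! ### Linear algebra at a point of a transversal lightlike submanifold -/

section Pointwise

variable {E : Type*} [NormedAddCommGroup E] [NormedSpace ℝ E]
  {N : Type*} [TopologicalSpace N] [ChartedSpace E N] [IsManifold 𝓘(ℝ, E) ∞ N]
  {F : Type*} [NormedAddCommGroup F] [NormedSpace ℝ F]
  {M : Type*} [TopologicalSpace M] [ChartedSpace F M] [IsManifold 𝓘(ℝ, F) ∞ M]
  {g : SemiRiemannianMetric F M} {P : GoldenStructure g}
  {f : N → M} {r : ℕ} {L : LightlikeSubmanifold (E := E) g f r} {x : N}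

theorem apply_mem_ltr (hL : L.IsTransversal P) {ξ : TangentSpace 𝓘(ℝ, E) x}
    (hξ : ξ ∈ radical (E := E) g f x) : P.toFun (f x) (diff f x ξ) ∈ L.ltr x :=
  hL.map_radical x ▸ ⟨_, ⟨ξ, hξ, rfl⟩, rfl⟩

theorem exists_eq_of_mem_ltr (hL : L.IsTransversal P) {l : TangentSpace 𝓘(ℝ, F) (f x)}
    (hl : l ∈ L.ltr x) : ∃ η ∈ radical (E := E) g f x, P.toFun (f x) (diff f x η) = l := by
  rw [← hL.map_radical x] at hl
  obtain ⟨_, ⟨η, hη, rfl⟩, rfl⟩ := hl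
  exact ⟨η, hη, rfl⟩

theorem apply_mem_screenTr (hL : L.IsTransversal P) {s : TangentSpace 𝓘(ℝ, E) x}
    (hs : s ∈ L.screen x) : P.toFun (f x) (diff f x s) ∈ L.screenTr x :=
  hL.map_screen x ⟨_, ⟨s, hs, rfl⟩, rfl⟩

/-- The pairing of `Rad TN` with `ltr(TN) = P (Rad TN)` is nondegenerate. -/
theorem eq_zero_of_val_apply_eq_zero (hL : L.IsTransversal P) {ρ : TangentSpace 𝓘(ℝ, E) x}
    (hρ : ρ ∈ radical (E := E) g f x)
    (h : ∀ ξ ∈ radical (E := E) g f x,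
      g.val (f x) (diff f x ρ) (P.toFun (f x) (diff f x ξ)) = 0) : ρ = 0 := by
  apply L.injective_diff x
  rw [map_zero]
  refine g.nondegenerate (f x) _ fun w ↦ ?_
  -- Split the test vector `w`: its tangent part pairs to zero with the radical vector `ρ`, its
  -- `screenTr` part is normal, and its `ltr` part has the form `P η`, covered by `h`.
  obtain ⟨l, hl, z, hz, hlz⟩ := Submodule.mem_sup.1 (L.sub_diff_tangentPart_mem w)
  obtain ⟨η, hη, rfl⟩ := hL.exists_eq_of_mem_ltr hl
  rw [← sub_add_cancel w (diff f x (L.tangentPart x w)), ← hlz, map_add, map_add, h η hη, hρ,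
    g.symm, L.val_screenTr_diff hz]
  simp

/-- The `Rad TN`-component of a vector `v` is detected by the pairings of `v` with the vectors
`P ξ - ξ = P⁻¹ ξ`, `ξ ∈ Rad TN`. -/
theorem radicalPart_tangentPart_eq_zero_iff (hL : L.IsTransversal P)
    (v : TangentSpace 𝓘(ℝ, F) (f x)) :
    L.radicalPart x (L.tangentPart x v) = 0 ↔ ∀ ξ ∈ radical (E := E) g f x,
      g.val (f x) v (P.toFun (f x) (diff f x ξ)) = g.val (f x) v (diff f x ξ) := by
  obtain ⟨l, hl, z, hz, hlz⟩ := Submodule.mem_sup.1 (L.sub_diff_tangentPart_mem v)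
  obtain ⟨η, hη, rfl⟩ := hL.exists_eq_of_mem_ltr hl
  have hρ := L.radicalPart_mem (L.tangentPart x v)
  have hσ := L.sub_radicalPart_mem (L.tangentPart x v)
  set t := L.tangentPart x v
  set ρ := L.radicalPart x t
  have hv : v = diff f x ρ + diff f x (t - ρ) + P.toFun (f x) (diff f x η) + z := by
    rw [← map_add, add_sub_cancel, add_assoc, hlz, add_sub_cancel]
  have key (ξ : TangentSpace 𝓘(ℝ, E) x) (hξ : ξ ∈ radical (E := E) g f x) :
      g.val (f x) v (P.toFun (f x) (diff f x ξ)) - g.val (f x) v (diff f x ξ) =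
        g.val (f x) (diff f x ρ) (P.toFun (f x) (diff f x ξ)) := by
    have hPξ := hL.apply_mem_ltr hξ
    have h1 : g.val (f x) (diff f x ρ) (diff f x ξ) = 0 := hρ ξ
    have h2 : g.val (f x) (diff f x (t - ρ)) (P.toFun (f x) (diff f x ξ)) = 0 := by
      rw [g.symm]; exact L.ltr_orthogonal_screen x _ hPξ _ hσ
    have h3 : g.val (f x) (diff f x (t - ρ)) (diff f x ξ) = 0 := by
      rw [g.symm]; exact hξ _
    -- This term dictates pairing with `P ξ - ξ` rather than `P ξ`: as `ltr` need not be null,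
    -- `g(Pη, Pξ)` need not vanish, but it exceeds `g(Pη, ξ)` only by `g(η, ξ) = 0`.
    have h4 : g.val (f x) (P.toFun (f x) (diff f x η)) (P.toFun (f x) (diff f x ξ)) =
        g.val (f x) (P.toFun (f x) (diff f x η)) (diff f x ξ) := by
      rw [← P.compatible, P.sq_eq, map_add, add_apply, show g.val (f x) (diff f x η) (diff f x ξ) = 0
        from hη ξ, add_zero]
    have h5 : g.val (f x) z (P.toFun (f x) (diff f x ξ)) = 0 := by
      rw [g.symm]; exact L.ltr_orthogonal_screenTr x _ hPξ _ hz
    have h6 := L.val_screenTr_diff hz ξ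
    rw [hv]
    simp only [map_add, add_apply] at *
    linarith
  constructor
  · intro h ξ hξ
    have := key ξ hξ
    rw [h, map_zero, map_zero, zero_apply] at this
    linarith
  · intro h
    refine hL.eq_zero_of_val_apply_eq_zero hρ fun ξ hξ ↦ ?_
    rw [← key ξ hξ, h ξ hξ, sub_self]

end Pointwise

/-! ### Antisymmetry of the derivative on the screen -/

section Sections

variable {E : Type*} [NormedAddCommGroup E] [NormedSpace ℝ E] [FiniteDimensional ℝ E]
  {N : Type*} [TopologicalSpace N] [ChartedSpace E N] [IsManifold 𝓘(ℝ, E) ∞ N]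
  {F : Type*} [NormedAddCommGroup F] [NormedSpace ℝ F] [FiniteDimensional ℝ F]
  {M : Type*} [TopologicalSpace M] [ChartedSpace F M] [IsManifold 𝓘(ℝ, F) ∞ M]
  {g : SemiRiemannianMetric F M}
  {D : CovariantDerivative 𝓘(ℝ, F) F (TangentSpace 𝓘(ℝ, F) : M → Type _)}
  {P : GoldenStructure g} {f : N → M} {r : ℕ} {L : LightlikeSubmanifold (E := E) g f r}
  {W U : Π x : N, TangentSpace 𝓘(ℝ, E) x}

/-- `g(D_W U, P ξ)` is antisymmetric in the sections `W`, `U` of the screen distribution. -/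
theorem val_covAlong_apply_antisymm (hD : IsLeviCivita g D) (hP : P.IsLocallyGolden D)
    (hL : L.IsTransversal P) (hW : IsSmoothSection L.screen W) (hU : IsSmoothSection L.screen U)
    (x : N) (ξ : TangentSpace 𝓘(ℝ, E) x) :
    g.val (f x) (covAlong D f (fun y ↦ diff f y (U y)) x (W x)) (P.toFun (f x) (diff f x ξ)) =
      -g.val (f x) (covAlong D f (fun y ↦ diff f y (W y)) x (U x))
        (P.toFun (f x) (diff f x ξ)) := by
  have hf := L.contMDiff
  have hfx : MDifferentiableAt 𝓘(ℝ, E) 𝓘(ℝ, F) f x := hf.mdifferentiable (by simp) x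
  set X : Π y : N, TangentSpace 𝓘(ℝ, E) y := FiberBundle.extend E ξ
  have hX : MDifferentiableAt 𝓘(ℝ, E) 𝓘(ℝ, E).tangent
      (fun y ↦ (⟨y, X y⟩ : TangentBundle 𝓘(ℝ, E) N)) x := mdifferentiableAt_extend' ξ
  have hXx : X x = ξ := FiberBundle.extend_apply_self E ξ
  -- `P` moves sections of the screen into `TN^⊥`
  have horth {A : Π y : N, TangentSpace 𝓘(ℝ, E) y} (hA : IsSmoothSection L.screen A)
      (B : Π y : N, TangentSpace 𝓘(ℝ, E) y) (y : N) :
      g.val (f y) (P.toFun (f y) (diff f y (A y))) (diff f y (B y)) = 0 :=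
    L.val_screenTr_diff (hL.apply_mem_screenTr (hA.2 y)) _
  -- hence `g(D_w (P A), B) = -g(P A, D_w B)`
  have hmet {A B : Π y : N, TangentSpace 𝓘(ℝ, E) y} (hA : IsSmoothSection L.screen A)
      (hB : MDifferentiableAt 𝓘(ℝ, E) 𝓘(ℝ, E).tangent
        (fun y ↦ (⟨y, B y⟩ : TangentBundle 𝓘(ℝ, E) N)) x) (w : TangentSpace 𝓘(ℝ, E) x) :
      g.val (f x) (P.toFun (f x) (covAlong D f (fun y ↦ diff f y (A y)) x w)) (diff f x (B x)) =
        -g.val (f x) (P.toFun (f x) (diff f x (A x)))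
          (covAlong D f (fun y ↦ diff f y (B y)) x w) := by
    have h := hD.mvfderiv_along hfx
      (P.mdifferentiableAt_apply_diff hf (hA.mdifferentiableAt x))
      (mdifferentiableAt_diff_apply hf hB) w
    rw [hP.covAlong hfx (mdifferentiableAt_diff_apply hf (hA.mdifferentiableAt x)),
      funext (horth hA B), mvfderiv_const] at h
    exact eq_neg_of_add_eq_zero_left h.symm
  -- exchanging the arguments of `D` in `g(P A, D_X B)`
  have hcomm {A B C : Π y : N, TangentSpace 𝓘(ℝ, E) y} (hA : IsSmoothSection L.screen A)
      (hB : MDifferentiableAt 𝓘(ℝ, E) 𝓘(ℝ, E).tangent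
        (fun y ↦ (⟨y, B y⟩ : TangentBundle 𝓘(ℝ, E) N)) x)
      (hC : MDifferentiableAt 𝓘(ℝ, E) 𝓘(ℝ, E).tangent
        (fun y ↦ (⟨y, C y⟩ : TangentBundle 𝓘(ℝ, E) N)) x) :
      g.val (f x) (P.toFun (f x) (diff f x (A x))) (covAlong D f (fun y ↦ diff f y (B y)) x (C x)) =
        g.val (f x) (P.toFun (f x) (diff f x (A x)))
          (covAlong D f (fun y ↦ diff f y (C y)) x (B x)) := by
    rw [← sub_eq_zero, ← map_sub, hD.covAlong_diff_sub hf hC hB]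
    exact L.val_screenTr_diff (hL.apply_mem_screenTr (hA.2 x)) _
  -- Differentiate `g(PA, X) = 0` along `B`, then exchange `B` and `X`; the differentiation is now
  -- along `ξ`.
  have hswap {A B : Π y : N, TangentSpace 𝓘(ℝ, E) y} (hA : IsSmoothSection L.screen A)
      (hB : IsSmoothSection L.screen B) :
      g.val (f x) (covAlong D f (fun y ↦ diff f y (A y)) x (B x)) (P.toFun (f x) (diff f x ξ)) =
        -g.val (f x) (P.toFun (f x) (diff f x (A x)))
          (covAlong D f (fun y ↦ diff f y (B y)) x ξ) := by
    have h := hmet hA hX (B x)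
    rw [hcomm hA hX (hB.mdifferentiableAt x), hXx] at h
    rw [← P.compatible, h]
  -- What remains is `g(PW, U) = 0` differentiated along `ξ`.
  rw [hswap hU hW, hswap hW hU, g.symm, ← P.compatible,
    hmet hW (hU.mdifferentiableAt x)]

end Sections

end IsTransversal

end LightlikeSubmanifold

end GoldenLightlike

/-! ### The main theorem -/

open GoldenLightlike in
theorem mainTheorem9
    {E : Type*} [NormedAddCommGroup E] [NormedSpace ℝ E] [FiniteDimensional ℝ E]
    {N : Type*} [TopologicalSpace N] [ChartedSpace E N] [IsManifold 𝓘(ℝ, E) ∞ N]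
    {F : Type*} [NormedAddCommGroup F] [NormedSpace ℝ F] [FiniteDimensional ℝ F]
    {M : Type*} [TopologicalSpace M] [ChartedSpace F M] [IsManifold 𝓘(ℝ, F) ∞ M]
    (g : SemiRiemannianMetric F M)
    (D : CovariantDerivative 𝓘(ℝ, F) F (TangentSpace 𝓘(ℝ, F) : M → Type _))
    (hD : IsLeviCivita g D)
    (P : GoldenStructure g) (hP : P.IsLocallyGolden D)
    (f : N → M) (r : ℕ) (L : LightlikeSubmanifold (E := E) g f r) (hL : L.IsTransversal P) :
    L.ScreenTotallyGeodesic D ↔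
      (∀ W U : Π x : N, TangentSpace 𝓘(ℝ, E) x,
        IsSmoothSection L.screen W → IsSmoothSection L.screen U → ∀ x : N,
          L.hStar D W U x = 0) ∧
      (∀ W U : Π x : N, TangentSpace 𝓘(ℝ, E) x,
        IsSmoothSection L.screen W → IsSmoothSection L.screen U → ∀ x : N,
          L.radicalPart x (L.shape D (fun y ↦ P.toFun (f y) (diff f y (U y))) W x) = 0) := by
  have hf := L.contMDiff
  have htors {W U : Π x : N, TangentSpace 𝓘(ℝ, E) x} (hW : IsSmoothSection L.screen W)
      (hU : IsSmoothSection L.screen U) (x : N) :=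
    hD.covAlong_diff_sub hf (hW.mdifferentiableAt x) (hU.mdifferentiableAt x)
  constructor
  · intro h
    have hstar : ∀ W U : Π x : N, TangentSpace 𝓘(ℝ, E) x,
        IsSmoothSection L.screen W → IsSmoothSection L.screen U → ∀ x : N,
          L.hStar D W U x = 0 := fun W U hW hU x ↦
      (L.radicalPart_eq_zero_iff _).2 (h W U hW hU x).2
    refine ⟨hstar, fun W U hW hU x ↦ ?_⟩
    have hneg (v : TangentSpace 𝓘(ℝ, E) x) : L.radicalPart x (-v) = -L.radicalPart x v :=
      map_neg _ v
    rw [LightlikeSubmanifold.shape, hneg, neg_eq_zero,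
      hL.radicalPart_tangentPart_eq_zero_iff, hP.covAlong (hf.mdifferentiable (by simp) x)
        (mdifferentiableAt_diff_apply hf (hU.mdifferentiableAt x))]
    intro ξ hξ
    have h1 := (hL.radicalPart_tangentPart_eq_zero_iff _).1 (hstar W U hW hU x) ξ hξ
    have h2 := (hL.radicalPart_tangentPart_eq_zero_iff _).1 (hstar U W hU hW x) ξ hξ
    have h3 := hL.val_covAlong_apply_antisymm hD hP hW hU x ξ
    -- The two sides differ by the pairing of the tangent vector `[W, U]` with the radical vector
    -- `ξ`.
    have h4 : g.val (f x) (covAlong D f (fun y ↦ diff f y (U y)) x (W x)) (diff f x ξ) =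
        g.val (f x) (covAlong D f (fun y ↦ diff f y (W y)) x (U x)) (diff f x ξ) := by
      rw [← sub_eq_zero, ← sub_apply, ← map_sub, htors hW hU x, g.symm]
      exact hξ _
    -- The golden relation reduces the goal to `g(D_W U, ξ) = 0`, a quantity that is symmetric by
    -- `h4` and, through `h1` and `h2`, antisymmetric by `h3`.
    rw [P.compatible, P.sq_eq, map_add, P.compatible]
    linarith
  · rintro ⟨h, -⟩ W U hW hU x
    have hmem {W U : Π x : N, TangentSpace 𝓘(ℝ, E) x} (hW : IsSmoothSection L.screen W)
        (hU : IsSmoothSection L.screen U) : L.inducedCov D W U x ∈ L.screen x :=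
      (L.radicalPart_eq_zero_iff _).1 (h W U hW hU x)
    refine ⟨?_, hmem hW hU⟩
    -- The induced connection inherits zero torsion, so the bracket is a difference of two screen
    -- vectors.
    rw [← L.tangentPart_diff (VectorField.mlieBracket 𝓘(ℝ, E) W U x), ← htors hW hU x,
      L.tangentPart_sub]
    exact Submodule.sub_mem _ (hmem hW hU) (hmem hU hW)
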